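/- **Theorem (FFT lower bound).** For $n=2^k$, the FFT (butterfly) DAG has the vertices $(i,j)$ with $0\le i\le k$ and $0\le j<n$, and each $(i,j)$ with $i<k$ has out-edges to $(i+1,j)$ and $(i+1,j\oplus 2^i)$, where $\oplus$ is the bitwise exclusive or. Inputs are the vertices of in-degree $0$, outputs those of out-degree $0$. The asymmetric RAM has a fast memory of $M\ge 1$ words, a slow memory of unboundedly many words, and an integer write cost $\omega\ge 1$. A word holds at most one vertex value. Each instruction either copies a word; or computes the value of a non-input vertex $v$ by reading the values of all immediate predecessors of $v$ from memory and writes the result to a word; or reads some words and overwrites at most one word with data that is not a vertex value. Each operand and result may be in fast or in slow memory. The I/O cost $Q$ of an instruction sequence is the number of reads from slow memory plus $\omega$ times the number of writes to slow memory; its work $W$ is $Q$ plus the number of reads from and writes to fast memory. An evaluation of the DAG is an instruction sequence that starts with the memory holding the values of all inputs and no other vertex values, and ends with the memory holding the values of all outputs. Vertices may be recomputed arbitrarily often. There is an absolute constant $c>0$ such that for all integers $M\ge1$, $\omega\ge 1$ and $n=2^k$ with $k\ge 0$, every evaluation of the $n$-input FFT DAG satisfies $$W\ \ge\ c\,\bigl(Q+n\log_2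 n\bigr),$$ and, if $\omega M\ge 2$ and either all outputs are in slow memory at the end or $n\ge 2M$, also $$Q\ \ge\ c\,\frac{\omega\, n\log_2 n}{\log_2(\omega M)} .$$ -/

import Mathlib

/-! ### DAG computations on the asymmetric RAM

A machine with a fast memory of `M` words and a slow memory with one word for each natural number
runs a sequence of instructions. Values of DAG vertices are atomic: a memory word holds the value
of one vertex, or no vertex value at all (it is empty or holds unrelated data). -/

namespace AsymRAM

/-- A memory location: `Sum.inl i` is word `i` of the fast memory (which has `M` words), and
`Sum.inr a` is word `a` of the slow memory (which is unbounded). -/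
abbrev Loc (M : ℕ) : Type := Fin M ⊕ ℕ

/-- The contents of the memory: which vertex value, if any, each word holds. -/
abbrev Memory (M : ℕ) (V : Type) : Type := Loc M → Option V

/-- The instructions. Operands and results may lie in either of the two memories. -/
inductive Instr (M : ℕ) (V : Type) : Type
  /-- Copy the word at `src` to `dst`. With `src` slow and `dst` fast this is a load from slow
  memory, with `src` fast and `dst` slow a store to slow memory. -/
  | copy (src dst : Loc M)
  /-- Compute the value of the vertex `v`, reading the value of each immediate predecessor `u`
  of `v` from the location `src u`, and write the result to `dst`. The locations `src u` for other
  vertices `u` play no role. -/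
  | compute (v : V) (src : V → Loc M) (dst : Loc M)
  /-- Any other instruction (index arithmetic, branching, erasing, ...): it reads the given
  words and, if `dst` is `some d`, overwrites `d` with data that is no vertex value. -/
  | aux (reads : List (Loc M)) (dst : Option (Loc M))

variable {M : ℕ} {V : Type}

/-- An input vertex of a DAG: one of in-degree `0`. -/
def IsInput (G : Digraph V) (v : V) : Prop := ∀ u, ¬ G.Adj u v

/-- An output vertex of a DAG: one of out-degree `0`. -/
def IsOutput (G : Digraph V) (v : V) : Prop := ∀ w, ¬ G.Adj v w

/-- The side condition of an instruction: only a non-input vertex can be computed, and only from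
the values of all its immediate predecessors. -/
def Instr.Enabled (G : Digraph V) (σ : Memory M V) : Instr M V → Prop
  | .copy _ _ => True
  | .compute v src _ => ¬ IsInput G v ∧ ∀ u, G.Adj u v → σ (src u) = some u
  | .aux _ _ => True

/-- The memory after an instruction. -/
def Instr.exec (σ : Memory M V) : Instr M V → Memory M V
  | .copy src dst => Function.update σ dst (σ src)
  | .compute v _ dst => Function.update σ dst (some v)
  | .aux _ none => σ
  | .aux _ (some d) => Function.update σ d none

/-- `Runs G P σ τ`: the instruction sequence `P` can be executed from memory `σ` and ends in
memory `τ`. -/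
def Runs (G : Digraph V) : List (Instr M V) → Memory M V → Memory M V → Prop
  | [], σ, τ => τ = σ
  | I :: P, σ, τ => I.Enabled G σ ∧ Runs G P (I.exec σ) τ

/-- The execution of `P` from memory `σ` to memory `τ` solves the DAG computation problem for `G`:
at the start, the memory holds the value of every input vertex and no other vertex values; at the
end, it holds the value of every output vertex. Vertices may be computed any number of times. -/
structure Evaluates (G : Digraph V) (P : List (Instr M V)) (σ τ : Memory M V) : Prop where
  runs : Runs G P σ τ
  inputs_available : ∀ v, IsInput G v → ∃ l, σ l = some v
  only_inputs : ∀ l v, σ l = some v → IsInput G v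
  outputs_available : ∀ v, IsOutput G v → ∃ l, τ l = some v

/-- Every output value is in slow memory in the memory `τ`. -/
def OutputsInSlow (G : Digraph V) (τ : Memory M V) : Prop :=
  ∀ v, IsOutput G v → ∃ a : ℕ, τ (Sum.inr a) = some v

open Classical in
/-- The words read by an instruction, with multiplicity. -/
noncomputable def Instr.reads [Fintype V] (G : Digraph V) : Instr M V → Multiset (Loc M)
  | .copy src _ => {src}
  | .compute v src _ => (Finset.univ.filter fun u => G.Adj u v).val.map src
  | .aux reads _ => (reads : Multiset (Loc M))

/-- The words written by an instruction. -/
def Instr.writes : Instr M V → Multiset (Loc M)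
  | .copy _ dst => {dst}
  | .compute _ _ dst => {dst}
  | .aux _ none => 0
  | .aux _ (some d) => {d}

/-- The number of slow-memory words in a multiset of locations. -/
def slowCount (s : Multiset (Loc M)) : ℕ := s.countP fun l => l.isRight = true

/-- The number of fast-memory words in a multiset of locations. -/
def fastCount (s : Multiset (Loc M)) : ℕ := s.countP fun l => l.isLeft = true

/-- The asymmetric I/O cost `Q`: the number of reads from slow memory plus `ω` times the number of
writes to slow memory. -/
noncomputable def ioCost [Fintype V] (G : Digraph V) (ω : ℕ) (P : List (Instr M V)) : ℕ :=
  (P.map fun I => slowCount (I.reads G) + ω * slowCount I.writes).sum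

/-- The asymmetric work `W`: the I/O cost plus the number of reads from and writes to fast
memory. -/
noncomputable def work [Fintype V] (G : Digraph V) (ω : ℕ) (P : List (Instr M V)) : ℕ :=
  ioCost G ω P + (P.map fun I => fastCount (I.reads G) + fastCount I.writes).sum

/-- The FFT (butterfly) DAG of input size `n = 2 ^ k`: the vertices are the pairs (level, row) with
`k + 1` levels and `2 ^ k` rows, and each vertex `(i, j)` with `i < k` has out-edges to `(i + 1, j)`
and `(i + 1, j XOR 2 ^ i)`. -/
def fftDAG (k : ℕ) : Digraph (Fin (k + 1) × Fin (2 ^ k)) where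
  Adj x y := (y.1 : ℕ) = (x.1 : ℕ) + 1 ∧
    ((y.2 : ℕ) = (x.2 : ℕ) ∨ (y.2 : ℕ) = (x.2 : ℕ) ^^^ 2 ^ (x.1 : ℕ))

end AsymRAM

namespace AsymRAM

open Finset Real

/-! ### The potential of a butterfly vertex -/

/-! The I/O bound is a potential argument. The potential of a vertex is its own weight plus the mean
of the potentials of its two predecessors. Since `j ↦ j ^^^ 2 ^ i` permutes the rows, the potentials
on one level sum to the total weight up to that level (`sum_potential`).

Cut the execution into blocks of I/O cost about `ω * M`. A block draws on values from `O(ω * M)`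
rows: at most `M` in fast memory at its start, plus those read from slow memory. If every value
present at the start has potential at least its level, then a value computed in the block falls
short of its level by at most the logarithm of the number of these rows above it; by AM-GM this
persists from the predecessors to the vertex (`NearFull.succ`). At most `2 * M` of the new values
survive the block: those in fast memory and those written to slow memory. Giving each survivor extra
weight `c`, at least the logarithm of the number of rows, restores the hypothesis for the next block
(`BlockInv.close`).

At the end all `2 ^ k` outputs have potential at least `k`, so `2 ^ k * k` is at most `c` times the
number of survivors, counted with multiplicity. As `ω` times that number is at most `2 * (Q + ω *
M)` (`BlockInv.exists_weight`), the bound follows up to the term `ω * M`, which is absorbed by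
counting writes of outputs.

The work bound holds because every non-input vertex must be computed and every computation writes a
word. -/

/-- The weight of a vertex and all its ancestors, an ancestor at distance `d` being counted with
factor `2 ^ (-d)`. -/
noncomputable def potential (w : ℕ × ℕ → ℝ) : ℕ → ℕ → ℝ
  | 0, j => w (0, j)
  | i + 1, j => w (i + 1, j) + (potential w i j + potential w i (j ^^^ 2 ^ i)) / 2

theorem potential_mono {w w' : ℕ × ℕ → ℝ} (h : ∀ x, w x ≤ w' x) :
    ∀ i j, potential w i j ≤ potential w' i j
  | 0, j => h _
  | i + 1, j => by
    have h1 := potential_mono h i j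
    have h2 := potential_mono h i (j ^^^ 2 ^ i)
    have h3 := h (i + 1, j)
    simp only [potential]
    linarith

theorem potential_add_le {w w' : ℕ × ℕ → ℝ} (h : ∀ x, w x ≤ w' x) {i j : ℕ} {c : ℝ}
    (hc : w (i, j) + c ≤ w' (i, j)) : potential w i j + c ≤ potential w' i j := by
  cases i with
  | zero => exact hc
  | succ i =>
    have h1 := potential_mono h i j
    have h2 := potential_mono h i (j ^^^ 2 ^ i)
    simp only [potential]
    linarith

theorem sum_range_xor_two_pow {i k : ℕ} (h : i < k) (f : ℕ → ℝ) :
    ∑ j ∈ range (2 ^ k), f (j ^^^ 2 ^ i) = ∑ j ∈ range (2 ^ k), f j := by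
  have hlt : ∀ j ∈ range (2 ^ k), j ^^^ 2 ^ i ∈ range (2 ^ k) := fun j hj =>
    mem_range.2 (Nat.xor_lt_two_pow (mem_range.1 hj) (Nat.pow_lt_pow_right (by norm_num) h))
  refine sum_nbij' (fun j => j ^^^ 2 ^ i) (fun j => j ^^^ 2 ^ i) hlt hlt ?_ ?_ fun _ _ => rfl <;>
  · intro j _
    simp

/-- Each vertex passes half of its potential to each of its two successors, so no weight is lost or
gained from level to level. -/
theorem sum_potential (w : ℕ × ℕ → ℝ) (k : ℕ) : ∀ i ≤ k,
    ∑ j ∈ range (2 ^ k), potential w i j = ∑ x ∈ range (i + 1) ×ˢ range (2 ^ k), w x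
  | 0, _ => by simp [potential]
  | i + 1, h => by
    have ih := sum_potential w k i (by omega)
    rw [sum_product] at ih ⊢
    rw [sum_range_succ _ (i + 1), ← ih]
    simp only [potential, sum_add_distrib, ← sum_div, sum_range_xor_two_pow (i := i) (k := k) h]
    ring

/-- The weight function of a multiset of vertices. -/
noncomputable def weight (c : ℝ) (m : Multiset (ℕ × ℕ)) (x : ℕ × ℕ) : ℝ := c * m.count x

theorem weight_mono {c : ℝ} (hc : 0 ≤ c) (m s : Multiset (ℕ × ℕ)) (x : ℕ × ℕ) :
    weight c m x ≤ weight c (m + s) x := by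
  unfold weight
  gcongr
  exact Multiset.le_add_right m s

theorem weight_add_le {c : ℝ} (hc : 0 ≤ c) (m : Multiset (ℕ × ℕ)) {s : Multiset (ℕ × ℕ)}
    {x : ℕ × ℕ} (hx : x ∈ s) : weight c m x + c ≤ weight c (m + s) x := by
  have h : (1 : ℝ) ≤ s.count x := by exact_mod_cast Multiset.one_le_count_iff_mem.2 hx
  simp only [weight, Multiset.count_add, Nat.cast_add]
  nlinarith

theorem sum_weight_le {c : ℝ} (hc : 0 ≤ c) (m : Multiset (ℕ × ℕ)) (s : Finset (ℕ × ℕ)) :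
    ∑ x ∈ s, weight c m x ≤ c * m.card := by
  simp only [weight, ← mul_sum]
  gcongr
  have h : ∑ x ∈ s, m.count x ≤ m.card := by
    rw [← Multiset.toFinset_sum_count_eq m]
    refine sum_le_sum_of_ne_zero fun x _ hx => ?_
    simpa using hx
  exact_mod_cast h

/-! ### Vertices computable from few values -/

/-- The number of elements of `D` that agree with `j` in the bits from position `i` upwards. The
ancestors of a vertex `(i, j)` all lie in such rows. -/
def rowCount (D : Finset ℕ) (i j : ℕ) : ℕ := #{x ∈ D | x >>> i = j >>> i}

theorem rowCount_mono {D D' : Finset ℕ} (h : D ⊆ D') (i j : ℕ) :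
    rowCount D i j ≤ rowCount D' i j :=
  card_le_card (filter_subset_filter _ h)

/-- The ancestor cones of the two predecessors of `(i + 1, j)` occupy disjoint sets of rows, told
apart by bit `i`. -/
theorem rowCount_add_rowCount_xor_le (D : Finset ℕ) (i j : ℕ) :
    rowCount D i j + rowCount D i (j ^^^ 2 ^ i) ≤ rowCount D (i + 1) j := by
  have hx : (j ^^^ 2 ^ i) >>> i = (j >>> i) ^^^ 1 := by
    rw [Nat.shiftRight_xor_distrib]
    simp [Nat.shiftRight_eq_div_pow]
  unfold rowCount
  rw [← card_union_of_disjoint]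
  · refine card_le_card fun x hx' => ?_
    simp only [mem_union, mem_filter, hx] at hx' ⊢
    rcases hx' with ⟨h, h'⟩ | ⟨h, h'⟩ <;> refine ⟨h, ?_⟩ <;>
      simp [Nat.shiftRight_add, h', Nat.shiftRight_xor_distrib]
  · refine disjoint_filter.2 fun x _ h h' => ?_
    rw [hx, h] at h'
    have := congrArg (fun y => (j >>> i) ^^^ y) h'
    simp at this

/-- The potential of the vertex `(i, j)` falls short of its level `i` by at most the logarithm of
the number of elements of `D` in the rows above it. -/
def NearFull (w : ℕ × ℕ → ℝ) (D : Finset ℕ) (i j : ℕ) : Prop :=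
  0 < rowCount D i j ∧ (i : ℝ) ≤ potential w i j + logb 2 (rowCount D i j)

theorem NearFull.mono {w : ℕ × ℕ → ℝ} {D D' : Finset ℕ} {i j : ℕ} (h : NearFull w D i j)
    (hD : D ⊆ D') : NearFull w D' i j := by
  have hc := rowCount_mono hD i j
  refine ⟨h.1.trans_le hc, h.2.trans ?_⟩
  gcongr
  · norm_num
  · exact_mod_cast h.1

theorem nearFull_of_mem {w : ℕ × ℕ → ℝ} {D : Finset ℕ} {i j : ℕ}
    (h : (i : ℝ) ≤ potential w i j) (hj : j ∈ D) : NearFull w D i j := by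
  have hpos : 0 < rowCount D i j := card_pos.2 ⟨j, by simp [hj]⟩
  refine ⟨hpos, h.trans (le_add_of_nonneg_right (logb_nonneg (by norm_num) ?_))⟩
  exact_mod_cast hpos

theorem NearFull.succ {w : ℕ × ℕ → ℝ} (hw : ∀ x, 0 ≤ w x) {D : Finset ℕ} {i j : ℕ}
    (h₁ : NearFull w D i j) (h₂ : NearFull w D i (j ^^^ 2 ^ i)) : NearFull w D (i + 1) j := by
  have hle := rowCount_add_rowCount_xor_le D i j
  obtain ⟨ha, h₁⟩ := h₁
  obtain ⟨hb, h₂⟩ := h₂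
  refine ⟨by omega, ?_⟩
  generalize rowCount D i j = a at *
  generalize rowCount D i (j ^^^ 2 ^ i) = b at *
  generalize rowCount D (i + 1) j = e at *
  have ha' : (0 : ℝ) < a := by exact_mod_cast ha
  have hb' : (0 : ℝ) < b := by exact_mod_cast hb
  have hle' : (a : ℝ) + b ≤ e := by exact_mod_cast hle
  -- AM-GM in the form `4ab ≤ (a + b)² ≤ e²`: averaging the two shortfalls loses exactly the one
  -- unit by which the level rises.
  have key : 2 + (logb 2 a + logb 2 b) ≤ 2 * logb 2 e := by
    calc 2 + (logb 2 a + logb 2 b) = logb 2 (2 ^ (2 : ℕ) * (a * b)) := by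
          rw [logb_mul (by positivity) (by positivity), logb_mul ha'.ne' hb'.ne', logb_pow,
            logb_self_eq_one (by norm_num)]
          norm_num
      _ ≤ logb 2 ((e : ℝ) ^ (2 : ℕ)) := by
          gcongr
          · norm_num
          · nlinarith [sq_nonneg ((a : ℝ) - b)]
      _ = 2 * logb 2 e := by rw [logb_pow]; norm_num
  have := hw (i + 1, j)
  simp only [potential]
  push_cast
  linarith

theorem NearFull.le_potential_add {w : ℕ × ℕ → ℝ} {D : Finset ℕ} {i j d : ℕ} {c : ℝ}
    (h : NearFull w D i j) (hD : #D ≤ d) (hc : logb 2 d ≤ c) : (i : ℝ) ≤ potential w i j + c := by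
  have hcard : rowCount D i j ≤ d := (card_filter_le _ _).trans hD
  have : logb 2 (rowCount D i j) ≤ logb 2 d := by
    gcongr
    · norm_num
    · exact_mod_cast h.1
  linarith [h.2]

/-! ### Blocks of instructions -/

/-- The instruction writes at most one word, and changes no other word. -/
theorem Instr.exec_cases {M : ℕ} {V : Type} (σ : Memory M V) (I : Instr M V) :
    I.exec σ = σ ∨ ∃ d x, I.exec σ = Function.update σ d x ∧ I.writes = {d} := by
  rcases I with ⟨src, dst⟩ | ⟨v, src, dst⟩ | ⟨reads, _ | d⟩
  · exact .inr ⟨_, _, rfl, rfl⟩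
  · exact .inr ⟨_, _, rfl, rfl⟩
  · exact .inl rfl
  · exact .inr ⟨_, _, rfl, rfl⟩

@[simp] theorem slowCount_zero {M : ℕ} : slowCount (0 : Multiset (Loc M)) = 0 := rfl

@[simp] theorem slowCount_singleton {M : ℕ} (l : Loc M) :
    slowCount {l} = if l.isRight = true then 1 else 0 := by
  unfold slowCount
  rw [← Multiset.cons_zero, Multiset.countP_cons, Multiset.countP_zero, zero_add]

theorem slowCount_writes_le {M : ℕ} {V : Type} (I : Instr M V) : slowCount I.writes ≤ 1 := by
  rcases I with ⟨src, dst⟩ | ⟨v, src, dst⟩ | ⟨reads, _ | d⟩ <;>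
    simp only [Instr.writes, slowCount_singleton, slowCount_zero] <;> first | omega | split <;> omega

/-- The vertices whose values are in fast memory. -/
def fastValues {M : ℕ} {V : Type} [DecidableEq V] (σ : Memory M V) : Finset V :=
  univ.biUnion fun i => (σ (Sum.inl i)).toFinset

theorem mem_fastValues {M : ℕ} {V : Type} [DecidableEq V] {σ : Memory M V} {v : V} :
    v ∈ fastValues σ ↔ ∃ i, σ (Sum.inl i) = some v := by
  simp [fastValues]

theorem card_fastValues_le {M : ℕ} {V : Type} [DecidableEq V] (σ : Memory M V) :
    #(fastValues σ) ≤ M := by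
  refine (card_biUnion_le_card_mul _ _ 1 fun i _ => ?_).trans (by simp)
  cases σ (Sum.inl i) <;> simp

/-- The vertices of the butterfly on `2 ^ k` inputs. -/
abbrev Vertex (k : ℕ) : Type := Fin (k + 1) × Fin (2 ^ k)

/-- The level and the row of a vertex, as natural numbers. -/
def Vertex.toNat {k : ℕ} (v : Vertex k) : ℕ × ℕ := (v.1, v.2)

variable {M k : ℕ}

/-- The situation in the middle of a block of instructions: since the block started, values from
the rows `D` were available, and the values of `U` were written to slow memory. -/
structure BlockInv (σ : Memory M (Vertex k)) (w : ℕ × ℕ → ℝ) (D : Finset ℕ)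
    (U : Finset (Vertex k)) : Prop where
  fast : ∀ i v, σ (Sum.inl i) = some v → NearFull w D v.1 v.2
  slow : ∀ a v, σ (Sum.inr a) = some v →
    (v.1 : ℝ) ≤ potential w v.1 v.2 ∨ v ∈ U ∧ NearFull w D v.1 v.2

namespace BlockInv

variable {σ : Memory M (Vertex k)} {w : ℕ × ℕ → ℝ} {D D' : Finset ℕ} {U : Finset (Vertex k)}

theorem mono (h : BlockInv σ w D U) (hD : D ⊆ D') : BlockInv σ w D' U where
  fast i v hv := (h.fast i v hv).mono hD
  slow a v hv := (h.slow a v hv).imp id fun ⟨hU, hn⟩ => ⟨hU, hn.mono hD⟩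

theorem read (h : BlockInv σ w D U) {l : Loc M} {v : Vertex k} (hv : σ l = some v)
    (hl : l.isRight = true → (v.2 : ℕ) ∈ D) : NearFull w D v.1 v.2 := by
  rcases l with i | a
  · exact h.fast i v hv
  · rcases h.slow a v hv with h' | h'
    · exact nearFull_of_mem h' (hl rfl)
    · exact h'.2

theorem write (h : BlockInv σ w D U) (d : Loc M) {x : Option (Vertex k)}
    (hx : ∀ v, x = some v → NearFull w D v.1 v.2) :
    ∃ U', BlockInv (Function.update σ d x) w D U' ∧ #U' ≤ #U + slowCount {d} := by
  rcases d with i | a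
  · refine ⟨U, ⟨fun i' v hv => ?_, fun a' v hv => ?_⟩, by simp⟩
    · by_cases hi : i' = i
      · subst hi
        exact hx v (by simpa using hv)
      · exact h.fast i' v (by simpa [Function.update_of_ne, hi] using hv)
    · exact h.slow a' v (by simpa using hv)
  · refine ⟨U ∪ x.toFinset, ⟨fun i' v hv => ?_, fun a' v hv => ?_⟩, ?_⟩
    · exact h.fast i' v (by simpa using hv)
    · by_cases ha : a' = a
      · subst ha
        have hv' : x = some v := by simpa using hv
        exact .inr ⟨by simp [hv'], hx v hv'⟩
      · exact (h.slow a' v (by simpa [Function.update_of_ne, ha] using hv)).imp id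
          fun ⟨hU, hn⟩ => ⟨mem_union_left _ hU, hn⟩
    · refine (card_union_le _ _).trans ?_
      cases x <;> simp

/-- A vertex all of whose predecessors are read has been computed from the rows `D`. -/
theorem compute (h : BlockInv σ w D U) (hw : ∀ x, 0 ≤ w x) {v : Vertex k}
    {src : Vertex k → Loc M} (hin : ¬ IsInput (fftDAG k) v)
    (hpre : ∀ u, (fftDAG k).Adj u v → σ (src u) = some u)
    (hD : ∀ u, (fftDAG k).Adj u v → (src u).isRight = true → (u.2 : ℕ) ∈ D) :
    NearFull w D v.1 v.2 := by
  obtain ⟨⟨i, hi⟩, ⟨j, hj⟩⟩ := v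
  have hread : ∀ u, (fftDAG k).Adj u (⟨i, hi⟩, ⟨j, hj⟩) → NearFull w D u.1 u.2 :=
    fun u hu => h.read (hpre u hu) (hD u hu)
  cases i with
  | zero => exact absurd (fun u hu => by simpa using hu.1) hin
  | succ i =>
    have hxor : j ^^^ 2 ^ i < 2 ^ k :=
      Nat.xor_lt_two_pow hj (Nat.pow_lt_pow_right (by norm_num) (by omega))
    refine NearFull.succ hw (hread (⟨i, by omega⟩, ⟨j, hj⟩) ⟨rfl, .inl rfl⟩)
      (hread (⟨i, by omega⟩, ⟨j ^^^ 2 ^ i, hxor⟩) ⟨rfl, .inr ?_⟩)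
    simp

/-- The cap `2` is the in-degree of the butterfly. An `aux` instruction may read arbitrarily many
words, but no vertex value spreads from them, so it adds no rows. -/
theorem exec (h : BlockInv σ w D U) (hw : ∀ x, 0 ≤ w x) {I : Instr M (Vertex k)}
    (hI : I.Enabled (fftDAG k) σ) :
    ∃ D' U', BlockInv (I.exec σ) w D' U' ∧
      #D' ≤ #D + min 2 (slowCount (I.reads (fftDAG k))) ∧ #U' ≤ #U + slowCount I.writes := by
  classical
  rcases I with ⟨src, dst⟩ | ⟨v, src, dst⟩ | ⟨reads, _ | d⟩
  · let N : Finset ℕ := if src.isRight = true then (σ src).toFinset.image fun v => (v.2 : ℕ) else ∅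
    have h' := h.mono (D' := D ∪ N) subset_union_left
    obtain ⟨U', hU', hcard⟩ := h'.write dst (x := σ src) fun v hv =>
      h'.read hv fun hs => mem_union_right _ (by simp [N, hs, hv])
    refine ⟨_, U', hU', (card_union_le _ _).trans ?_, hcard⟩
    simp only [Instr.reads, slowCount_singleton, N]
    split_ifs
    · have : #(σ src).toFinset ≤ 1 := by cases σ src <;> simp
      have := card_image_le (s := (σ src).toFinset) (f := fun v => (v.2 : ℕ))
      omega
    · simp
  · let N : Finset ℕ := (univ.filter fun u => (fftDAG k).Adj u v ∧ (src u).isRight = true).image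
      fun u => (u.2 : ℕ)
    have h' := h.mono (D' := D ∪ N) subset_union_left
    obtain ⟨U', hU', hcard⟩ := h'.write dst (x := some v) fun v' hv' => by
      obtain rfl := Option.some.inj hv'
      exact h'.compute hw hI.1 hI.2 fun u hu hs =>
        mem_union_right _ (mem_image.2 ⟨u, by simp [hu, hs], rfl⟩)
    refine ⟨_, U', hU', (card_union_le _ _).trans ?_, hcard⟩
    have h₁ : #N ≤ 2 := by
      refine (card_le_card (t := {(v.2 : ℕ), (v.2 : ℕ) ^^^ 2 ^ ((v.1 : ℕ) - 1)})
        fun j hj => ?_).trans card_le_two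
      simp only [N, mem_image, mem_filter, mem_univ, true_and] at hj
      obtain ⟨u, ⟨⟨hi, hj'⟩, -⟩, rfl⟩ := hj
      simp only [mem_insert, mem_singleton, hi, Nat.add_sub_cancel]
      rcases hj' with h | h <;> simp [h]
    have h₂ : #N ≤ slowCount ((Instr.compute v src dst).reads (fftDAG k)) := by
      refine card_image_le.trans (le_of_eq ?_)
      simp only [Instr.reads, slowCount, Multiset.countP_map]
      rw [← filter_filter]
      rfl
    omega
  · exact ⟨D, U, h, by omega, by omega⟩
  · obtain ⟨U', hU', hcard⟩ := h.write d (x := none) fun v hv => by simp at hv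
    exact ⟨D, U', hU', by omega, hcard⟩

/-- At the end of a block, adding the surviving values to the weight makes all values in memory
reach their level. -/
theorem close {m : Multiset (ℕ × ℕ)} {c : ℝ} {d : ℕ} (hc : 0 ≤ c) (h : BlockInv σ (weight c m) D U)
    (hD : #D ≤ d) (hdc : logb 2 d ≤ c) {l : Loc M} {v : Vertex k} (hv : σ l = some v) :
    (v.1 : ℝ) ≤ potential (weight c (m + ((U ∪ fastValues σ).val.map Vertex.toNat))) v.1 v.2 := by
  have key : v ∈ U ∪ fastValues σ → NearFull (weight c m) D v.1 v.2 →
      (v.1 : ℝ) ≤ potential (weight c (m + ((U ∪ fastValues σ).val.map Vertex.toNat))) v.1 v.2 :=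
    fun hmem hn => (hn.le_potential_add hD hdc).trans <|
      potential_add_le (weight_mono hc _ _) <|
        weight_add_le hc _ (Multiset.mem_map.2 ⟨v, hmem, rfl⟩)
  rcases l with i | a
  · exact key (mem_union_right _ (mem_fastValues.2 ⟨i, hv⟩)) (h.fast i v hv)
  · rcases h.slow a v hv with h' | ⟨hU, hn⟩
    · exact h'.trans (potential_mono (weight_mono hc _ _) _ _)
    · exact key (mem_union_left _ hU) hn

/-- A new block can start when all values in memory have reached their level. -/
theorem start (h : ∀ l v, σ l = some v → (v.1 : ℝ) ≤ potential w v.1 v.2) :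
    BlockInv σ w ((fastValues σ).image fun v => (v.2 : ℕ)) ∅ where
  fast i v hv := nearFull_of_mem (h _ v hv) (mem_image_of_mem _ (mem_fastValues.2 ⟨i, hv⟩))
  slow _ v hv := .inl (h _ v hv)

theorem card_start_le (σ : Memory M (Vertex k)) :
    #((fastValues σ).image fun v => (v.2 : ℕ)) ≤ M :=
  card_image_le.trans (card_fastValues_le σ)

end BlockInv

theorem weight_nonneg {c : ℝ} (hc : 0 ≤ c) (m : Multiset (ℕ × ℕ)) (x : ℕ × ℕ) : 0 ≤ weight c m x :=
  mul_nonneg hc (Nat.cast_nonneg _)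

theorem ioCost_cons {V : Type} [Fintype V] (G : Digraph V) (ω : ℕ) (I : Instr M V)
    (P : List (Instr M V)) : ioCost G ω (I :: P) =
      slowCount (I.reads G) + ω * slowCount I.writes + ioCost G ω P := by
  simp [ioCost]

/-- Few values survive the blocks of an execution, and weighting them makes every value in the final
memory reach its level. -/
theorem BlockInv.exists_weight {ω : ℕ} {c : ℝ} (hc : 0 ≤ c)
    (hdc : logb 2 ((M + (ω * M + 1) : ℕ) : ℝ) ≤ c) :
    ∀ (P : List (Instr M (Vertex k))) (σ τ : Memory M (Vertex k)) (m : Multiset (ℕ × ℕ))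
      (D : Finset ℕ) (U : Finset (Vertex k)) (r s : ℕ),
      BlockInv σ (weight c m) D U → #D ≤ M + r → #U ≤ s → r + ω * s < ω * M →
      Runs (fftDAG k) P σ τ →
      ∃ m' : Multiset (ℕ × ℕ),
        (∀ l v, τ l = some v → (v.1 : ℝ) ≤ potential (weight c m') v.1 v.2) ∧
        ω * m'.card ≤ ω * m.card + 2 * (r + ω * s + ioCost (fftDAG k) ω P + ω * M) := by
  have hsurv : ∀ (σ : Memory M (Vertex k)) (U : Finset (Vertex k)), #U ≤ M →
      ω * ((U ∪ fastValues σ).val.map Vertex.toNat).card ≤ 2 * (ω * M) := fun σ U hU => by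
    have h₁ : #(U ∪ fastValues σ) ≤ 2 * M := by
      have := card_union_le U (fastValues σ)
      have := card_fastValues_le σ
      omega
    rw [Multiset.card_map]
    calc ω * #(U ∪ fastValues σ) ≤ ω * (2 * M) := Nat.mul_le_mul_left _ h₁
      _ = 2 * (ω * M) := by ring
  have hsM : ∀ {r s : ℕ}, r + ω * s < ω * M → s < M := fun h =>
    Nat.lt_of_mul_lt_mul_left (lt_of_le_of_lt (Nat.le_add_left _ _) h)
  intro P
  induction P with
  | nil =>
    rintro σ τ m D U r s h hD hU hrs rfl
    -- The last block may be cheap; its survivors are charged to the extra `ω * M`.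
    refine ⟨_, fun l v hv => h.close hc (d := M + (ω * M + 1)) (by omega) hdc hv, ?_⟩
    have := hsurv τ U (hU.trans (hsM hrs).le)
    rw [Multiset.card_add, mul_add]
    omega
  | cons I P ih =>
    rintro σ τ m D U r s h hD hU hrs ⟨hI, hP⟩
    obtain ⟨D', U', h', hD', hU'⟩ := h.exec (weight_nonneg hc m) hI
    have hw1 := slowCount_writes_le I
    have hs := hsM hrs
    rw [ioCost_cons]
    generalize slowCount (I.reads (fftDAG k)) = a at *
    generalize slowCount I.writes = b at *
    -- Before the instruction `r ≤ ω * M - 1` and `s ≤ M - 1`. Even the instruction that ends the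
    -- block therefore leaves at most `M + (ω * M + 1)` rows and at most `M` values written to slow
    -- memory.
    by_cases hlt : r + min 2 a + ω * (s + b) < ω * M
    · obtain ⟨m', hm', hcard⟩ := ih _ _ m D' U' _ _ h' (by omega) (by omega) hlt hP
      refine ⟨m', hm', ?_⟩
      rw [mul_add ω s b] at hcard
      omega
    -- The finished block has cost at least `ω * M`, which pays for its at most `2 * M` survivors;
    -- the counters restart at `0`.
    · obtain ⟨m', hm', hcard⟩ := ih _ _ _ _ _ 0 0
        (BlockInv.start fun l v hv =>
          h'.close hc (d := M + (ω * M + 1)) (by omega) hdc hv)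
        (BlockInv.card_start_le _) (by simp) (by omega) hP
      refine ⟨m', hm', ?_⟩
      have := hsurv (I.exec σ) U' (by omega)
      rw [Multiset.card_add, mul_add] at hcard
      rw [mul_add] at hlt
      omega

/-! ### Counting writes and computations -/

@[simp] theorem fastCount_singleton (l : Loc M) :
    fastCount {l} = if l.isLeft = true then 1 else 0 := by
  unfold fastCount
  rw [← Multiset.cons_zero, Multiset.countP_cons, Multiset.countP_zero, zero_add]

/-- The number of writes to slow memory. -/
def slowWrites {V : Type} (P : List (Instr M V)) : ℕ := (P.map fun I => slowCount I.writes).sum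

theorem mul_slowWrites_le_ioCost {V : Type} [Fintype V] (G : Digraph V) (ω : ℕ)
    (P : List (Instr M V)) : ω * slowWrites P ≤ ioCost G ω P := by
  induction P with
  | nil => simp [slowWrites]
  | cons I P ih =>
    rw [ioCost_cons]
    simp only [slowWrites, List.map_cons, List.sum_cons, mul_add] at ih ⊢
    omega

/-- All but `slowWrites P` of the values in slow memory at the end were there at the start. -/
theorem exists_subset_slow_of_runs {V : Type} [DecidableEq V] {G : Digraph V} :
    ∀ (P : List (Instr M V)) (σ τ : Memory M V) (T : Finset V), Runs G P σ τ →
      (∀ v ∈ T, ∃ a, τ (Sum.inr a) = some v) →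
      ∃ T' ⊆ T, #T ≤ #T' + slowWrites P ∧ ∀ v ∈ T', ∃ a, σ (Sum.inr a) = some v := by
  intro P
  induction P with
  | nil =>
    rintro σ τ T rfl hT
    exact ⟨T, subset_rfl, by simp, hT⟩
  | cons I P ih =>
    rintro σ τ T ⟨-, hP⟩ hT
    obtain ⟨T', hsub, hcard, hT'⟩ := ih _ τ T hP hT
    have hcons : slowWrites (I :: P) = slowCount I.writes + slowWrites P := by simp [slowWrites]
    rcases I.exec_cases σ with h | ⟨d | a, x, h, hw⟩
    · exact ⟨T', hsub, by omega, by simpa [h] using hT'⟩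
    · exact ⟨T', hsub, by omega, by simpa [h] using hT'⟩
    · refine ⟨T' \ x.toFinset, sdiff_subset.trans hsub, ?_, fun v hv => ?_⟩
      · have h₁ : #T' ≤ #(T' \ x.toFinset) + #x.toFinset := by
          have := le_card_sdiff x.toFinset T'
          omega
        have h₂ : #x.toFinset ≤ 1 := by cases x <;> simp
        have h₃ : slowCount I.writes = 1 := by simp [hw]
        omega
      · obtain ⟨hv, hx⟩ := mem_sdiff.1 hv
        obtain ⟨b, hb⟩ := hT' v hv
        rw [h] at hb
        by_cases hba : b = a
        · subst hba
          exact absurd (by simpa using hb) hx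
        · exact ⟨b, by simpa [Function.update_of_ne, hba] using hb⟩

/-- The vertices computed by an execution are at most as many as its work, since each is written. -/
theorem exists_computed_of_runs {V : Type} [Fintype V] [DecidableEq V] {G : Digraph V} {ω : ℕ}
    (hω : 1 ≤ ω) :
    ∀ (P : List (Instr M V)) (σ τ : Memory M V), Runs G P σ τ →
      ∃ C : Finset V, #C ≤ work G ω P ∧
        (∀ l v, τ l = some v → v ∈ C ∨ ∃ l, σ l = some v) ∧
        ∀ v ∈ C, ∀ u, G.Adj u v → u ∈ C ∨ ∃ l, σ l = some u := by
  intro P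
  induction P with
  | nil =>
    rintro σ τ rfl
    exact ⟨∅, by simp, fun l v hv => .inr ⟨l, hv⟩, by simp⟩
  | cons I P ih =>
    rintro σ τ ⟨hI, hP⟩
    obtain ⟨C, hC, hτ, hpre⟩ := ih _ τ hP
    have hcons : work G ω (I :: P) = slowCount (I.reads G) + ω * slowCount I.writes +
        (fastCount (I.reads G) + fastCount I.writes) + work G ω P := by
      simp only [work, ioCost_cons, List.map_cons, List.sum_cons]
      omega
    by_cases hcomp : ∃ v src dst, I = .compute v src dst
    · obtain ⟨v, src, dst, rfl⟩ := hcomp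
      have hσ : ∀ u, (∃ l, (Instr.compute v src dst).exec σ l = some u) →
          u ∈ insert v C ∨ ∃ l, σ l = some u := by
        rintro u ⟨l, hl⟩
        rw [Instr.exec, Function.update_apply] at hl
        split_ifs at hl
        · exact .inl (by simp [Option.some.inj hl])
        · exact .inr ⟨l, hl⟩
      have hC' : ∀ u, (u ∈ C ∨ ∃ l, (Instr.compute v src dst).exec σ l = some u) →
          u ∈ insert v C ∨ ∃ l, σ l = some u := fun u hu =>
        hu.elim (fun h => .inl (mem_insert_of_mem h)) (hσ u)
      refine ⟨insert v C, ?_, fun l u hu => hC' u (hτ l u hu), fun x hx u hu => ?_⟩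
      · have h₁ := card_insert_le v C
        have h₂ : 1 ≤ ω * slowCount (Instr.compute v src dst).writes +
            fastCount (Instr.compute v src dst).writes := by
          rcases dst with i | a
          · simp [Instr.writes]
          · simpa [Instr.writes] using by omega
        omega
      · rcases mem_insert.1 hx with rfl | hx
        · exact .inr ⟨_, hI.2 u hu⟩
        · exact hC' u (hpre x hx u hu)
    · have hσ : ∀ u, (∃ l, I.exec σ l = some u) → ∃ l, σ l = some u := by
        rintro u ⟨l, hl⟩
        rcases I with ⟨src, dst⟩ | ⟨v, src, dst⟩ | ⟨reads, _ | d⟩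
        · rw [Instr.exec, Function.update_apply] at hl
          split_ifs at hl
          exacts [⟨_, hl⟩, ⟨_, hl⟩]
        · exact absurd ⟨_, _, _, rfl⟩ hcomp
        · exact ⟨_, hl⟩
        · rw [Instr.exec, Function.update_apply] at hl
          split_ifs at hl
          exact ⟨_, hl⟩
      exact ⟨C, by omega, fun l v hv => (hτ l v hv).imp id (hσ v),
        fun v hv u hu => (hpre v hv u hu).imp id (hσ u)⟩

/-! ### The butterfly -/

theorem isInput_fftDAG_iff {v : Vertex k} : IsInput (fftDAG k) v ↔ (v.1 : ℕ) = 0 := by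
  obtain ⟨⟨i, hi⟩, j⟩ := v
  constructor
  · intro h
    by_contra hne
    exact h (⟨i - 1, by omega⟩, j) ⟨by simp only at hne ⊢; omega, .inl rfl⟩
  · intro h u hu
    have := hu.1
    simp only at h this
    omega

theorem isOutput_fftDAG_iff {v : Vertex k} : IsOutput (fftDAG k) v ↔ (v.1 : ℕ) = k := by
  obtain ⟨⟨i, hi⟩, j⟩ := v
  constructor
  · intro h
    by_contra hne
    exact h (⟨i + 1, by simp only at hne; omega⟩, j) ⟨rfl, .inl rfl⟩
  · intro h u hu
    have h₁ := hu.1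
    have h₂ := u.1.isLt
    simp only at h h₁
    omega

/-- The output vertices. -/
def outputs (k : ℕ) : Finset (Vertex k) := univ.image fun j => (Fin.last k, j)

theorem card_outputs (k : ℕ) : #(outputs k) = 2 ^ k := by
  rw [outputs, card_image_of_injective _ fun _ _ h => (Prod.ext_iff.1 h).2]
  simp

theorem isOutput_of_mem_outputs {v : Vertex k} (hv : v ∈ outputs k) : IsOutput (fftDAG k) v := by
  obtain ⟨j, -, rfl⟩ := mem_image.1 hv
  exact isOutput_fftDAG_iff.2 rfl

variable {P : List (Instr M (Vertex k))} {σ τ : Memory M (Vertex k)}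

namespace Evaluates

theorem mul_two_pow_le_work {ω : ℕ} (hω : 1 ≤ ω) (h : Evaluates (fftDAG k) P σ τ) :
    k * 2 ^ k ≤ work (fftDAG k) ω P := by
  obtain ⟨C, hC, hτ, hpre⟩ := exists_computed_of_runs hω P σ τ h.runs
  have hin : ∀ v, (v ∈ C ∨ ∃ l, σ l = some v) → (v.1 : ℕ) ≠ 0 → v ∈ C := fun v hv h0 =>
    hv.resolve_right fun ⟨l, hl⟩ => h0 (isInput_fftDAG_iff.1 (h.only_inputs l v hl))
  -- Induction on the distance `d` to the outputs, along the straight edges `(i, j) → (i + 1, j)`.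
  have hall : ∀ (d : ℕ) (v : Vertex k), (v.1 : ℕ) + d = k → (v.1 : ℕ) ≠ 0 → v ∈ C := by
    intro d
    induction d with
    | zero =>
      intro v hv h0
      obtain ⟨l, hl⟩ := h.outputs_available v (isOutput_fftDAG_iff.2 hv)
      exact hin v (hτ l v hl) h0
    | succ d ih =>
      rintro ⟨⟨i, hi⟩, j⟩ hv h0
      simp only at hv h0
      exact hin _ (hpre (⟨i + 1, by omega⟩, j) (ih _ (by simp only; omega) (by simp)) _
        ⟨rfl, .inl rfl⟩) h0
  refine le_trans ?_ hC
  have hcard := card_le_card_of_injOn (s := (univ : Finset (Fin k × Fin (2 ^ k)))) (t := C)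
    (fun x => (x.1.succ, x.2))
    (fun x _ => hall (k - (x.1 + 1)) _ (by simp only [Fin.val_succ]; omega) (by simp))
    (fun x _ y _ hxy => by simpa [Prod.ext_iff] using hxy)
  simpa using hcard

/-- For `k ≠ 0` no output is an input, so none is in memory at the start and each one in slow memory
at the end was written there. -/
theorem card_le_slowWrites (h : Evaluates (fftDAG k) P σ τ) (hk : k ≠ 0) {T : Finset (Vertex k)}
    (hT : T ⊆ outputs k) (hτ : ∀ v ∈ T, ∃ a, τ (Sum.inr a) = some v) : #T ≤ slowWrites P := by
  obtain ⟨T', hsub, hcard, hσ⟩ := exists_subset_slow_of_runs P σ τ T h.runs hτ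
  have : T' = ∅ := eq_empty_of_forall_notMem fun v hv => by
    obtain ⟨a, ha⟩ := hσ v hv
    have h₁ := isInput_fftDAG_iff.1 (h.only_inputs _ v ha)
    have h₂ := isOutput_fftDAG_iff.1 (isOutput_of_mem_outputs (hT (hsub hv)))
    omega
  simpa [this] using hcard

theorem two_pow_le_slowWrites (h : Evaluates (fftDAG k) P σ τ) (hk : k ≠ 0)
    (hτ : OutputsInSlow (fftDAG k) τ) : 2 ^ k ≤ slowWrites P :=
  card_outputs k ▸ h.card_le_slowWrites hk subset_rfl fun v hv => hτ v (isOutput_of_mem_outputs hv)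

theorem two_pow_le_add_slowWrites (h : Evaluates (fftDAG k) P σ τ) (hk : k ≠ 0) :
    2 ^ k ≤ M + slowWrites P := by
  have h₁ := h.card_le_slowWrites hk (T := outputs k \ fastValues τ) sdiff_subset fun v hv => by
    obtain ⟨hv, hf⟩ := mem_sdiff.1 hv
    obtain ⟨i | a, hl⟩ := h.outputs_available v (isOutput_of_mem_outputs hv)
    · exact absurd (mem_fastValues.2 ⟨i, hl⟩) hf
    · exact ⟨a, hl⟩
  have h₂ := le_card_sdiff (fastValues τ) (outputs k)
  have h₃ := card_fastValues_le τ
  rw [card_outputs] at h₂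
  omega

/-- The lower bound for the I/O cost, up to the cost of one block. -/
theorem mul_two_pow_le_ioCost_add {ω : ℕ} (hω : 1 ≤ ω) (hM : 1 ≤ M)
    (h : Evaluates (fftDAG k) P σ τ) {c : ℝ} (hc : 0 ≤ c)
    (hdc : logb 2 ((M + (ω * M + 1) : ℕ) : ℝ) ≤ c) :
    (ω : ℝ) * (2 ^ k * k) ≤ c * (2 * (ioCost (fftDAG k) ω P + ω * M)) := by
  obtain ⟨m, hm, hcard⟩ := BlockInv.exists_weight hc hdc P σ τ 0 _ ∅ 0 0
    -- Initially only inputs are present, and they have level `0`, so the zero weight suffices.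
    (BlockInv.start fun l v hv => by
      rw [isInput_fftDAG_iff.1 (h.only_inputs l v hv)]
      simpa [potential] using weight_nonneg hc _ _)
    (BlockInv.card_start_le σ) (by simp) (by positivity) h.runs
  have hout : (2 : ℝ) ^ k * k ≤ ∑ j ∈ range (2 ^ k), potential (weight c m) k j := by
    refine le_trans (by simp) (card_nsmul_le_sum (range (2 ^ k)) _ (k : ℝ) fun j hj => ?_)
    obtain ⟨l, hl⟩ := h.outputs_available (Fin.last k, ⟨j, mem_range.1 hj⟩)
      (isOutput_fftDAG_iff.2 rfl)
    exact hm l _ hl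
  rw [sum_potential _ _ _ le_rfl] at hout
  have h₁ := hout.trans (sum_weight_le hc m _)
  have h₂ : (ω : ℝ) * m.card ≤ 2 * (ioCost (fftDAG k) ω P + ω * M) := by
    have : ω * m.card ≤ 2 * (ioCost (fftDAG k) ω P + ω * M) := by simpa using hcard
    exact_mod_cast this
  calc (ω : ℝ) * (2 ^ k * k) ≤ ω * (c * m.card) := by gcongr
    _ = c * (ω * m.card) := by ring
    _ ≤ _ := by gcongr

theorem mul_two_pow_le_ioCost_mul {ω : ℕ} (hω : 1 ≤ ω) (hM : 1 ≤ M)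
    (h : Evaluates (fftDAG k) P σ τ) (hωM : 2 ≤ ω * M)
    (hout : OutputsInSlow (fftDAG k) τ ∨ 2 * M ≤ 2 ^ k) :
    (ω : ℝ) * 2 ^ k * k ≤ 12 * logb 2 ((ω : ℝ) * M) * ioCost (fftDAG k) ω P := by
  rcases eq_or_ne k 0 with rfl | hk
  · have hx : (1 : ℝ) ≤ ω * M := by exact_mod_cast hωM.trans' one_le_two
    have := logb_nonneg (b := 2) (by norm_num) hx
    simp only [Nat.cast_zero, mul_zero]
    positivity
  have hx : (2 : ℝ) ≤ ω * M := by exact_mod_cast hωM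
  have hMr : (1 : ℝ) ≤ M := by exact_mod_cast hM
  have hωr : (1 : ℝ) ≤ ω := by exact_mod_cast hω
  have hMx : (M : ℝ) ≤ ω * M := le_mul_of_one_le_left (by linarith) hωr
  set L := logb 2 ((ω : ℝ) * M) with hL
  have hL1 : 1 ≤ L := by
    rw [hL, le_logb_iff_rpow_le (by norm_num) (by linarith)]
    simpa using hx
  -- With `x = ω * M ≥ 2`, the number of rows is at most `2x + 1 ≤ x ^ 3`.
  have hdc : logb 2 ((M + (ω * M + 1) : ℕ) : ℝ) ≤ 3 * L := by
    have : 3 * L = logb 2 (((ω : ℝ) * M) ^ 3) := by rw [logb_pow]; norm_num [hL]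
    rw [this]
    push_cast
    refine logb_le_logb_of_le (by norm_num) (by positivity) ?_
    nlinarith [mul_self_nonneg ((ω : ℝ) * M - 2)]
  have hmain := h.mul_two_pow_le_ioCost_add hω hM (by linarith) hdc
  have hsw : (ω : ℝ) * slowWrites P ≤ ioCost (fftDAG k) ω P := by
    exact_mod_cast mul_slowWrites_le_ioCost (fftDAG k) ω P
  generalize (ioCost (fftDAG k) ω P : ℝ) = Q at *
  rcases le_total ((ω : ℝ) * M) Q with hQ | hQ
  -- Here the additive `ω * M` is at most `Q`, and `3 * L * 2 * (Q + Q) = 12 * L * Q`.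
  · have : L * (ω * M) ≤ L * Q := by gcongr
    linarith
  have hn : (0 : ℝ) < 2 ^ k := by positivity
  -- When `Q ≤ ω * M`, writing half of the outputs to slow memory is already costly enough, as `k`
  -- is only `O(L)`. For `2 * M ≤ 2 ^ k` the main estimate itself gives `k ≤ 6 * L`, and at most `M`
  -- outputs can stay in fast memory; otherwise `2 ^ k ≤ 2 * (ω * M)` gives `k ≤ 1 + L`, and all
  -- outputs end in slow memory.
  have hfin : (k : ℝ) ≤ 6 * L → (2 : ℝ) ^ k ≤ 2 * slowWrites P →
      (ω : ℝ) * 2 ^ k * k ≤ 12 * L * Q := fun h₁ h₂ => by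
    calc (ω : ℝ) * 2 ^ k * k ≤ ω * (2 * slowWrites P) * (6 * L) := by gcongr
      _ = 12 * L * (ω * slowWrites P) := by ring
      _ ≤ 12 * L * Q := by gcongr
  by_cases h2M : 2 * M ≤ 2 ^ k
  · have h2M' : (2 : ℝ) * M ≤ 2 ^ k := by exact_mod_cast h2M
    refine hfin ?_ ?_
    · have h₁ : L * Q ≤ L * (ω * M) := by gcongr
      have h₂ : L * ω * (2 * M) ≤ L * ω * 2 ^ k := by gcongr
      have h₃ : (ω : ℝ) * 2 ^ k * k ≤ ω * 2 ^ k * (6 * L) := by linarith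
      exact le_of_mul_le_mul_left h₃ (by positivity)
    · have := h.two_pow_le_add_slowWrites hk
      exact_mod_cast (by omega : 2 ^ k ≤ 2 * slowWrites P)
  · refine hfin ?_ ?_
    · have h₁ : (2 : ℝ) ^ k ≤ 2 * M := by exact_mod_cast (not_le.1 h2M).le
      have h₂ : logb 2 ((2 : ℝ) ^ k) ≤ logb 2 (2 * (ω * M)) :=
        logb_le_logb_of_le (by norm_num) hn (by linarith)
      rw [logb_pow, logb_mul (by norm_num) (by positivity), logb_self_eq_one (by norm_num)] at h₂
      linarith
    · have := h.two_pow_le_slowWrites hk (hout.resolve_right h2M)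
      exact_mod_cast (by omega : 2 ^ k ≤ 2 * slowWrites P)

end Evaluates

end AsymRAM

theorem mainTheorem1 :
    ∃ c : ℝ, 0 < c ∧
      ∀ (M ω k n : ℕ), 1 ≤ M → 1 ≤ ω → n = 2 ^ k →
      ∀ (P : List (AsymRAM.Instr M (Fin (k + 1) × Fin (2 ^ k))))
        (σ τ : AsymRAM.Memory M (Fin (k + 1) × Fin (2 ^ k))),
        AsymRAM.Evaluates (AsymRAM.fftDAG k) P σ τ →
          (2 ≤ ω * M → AsymRAM.OutputsInSlow (AsymRAM.fftDAG k) τ ∨ 2 * M ≤ n →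
            c * ((ω : ℝ) * n * Real.logb 2 n / Real.logb 2 ((ω : ℝ) * M)) ≤
              (AsymRAM.ioCost (AsymRAM.fftDAG k) ω P : ℝ)) ∧
          c * ((AsymRAM.ioCost (AsymRAM.fftDAG k) ω P : ℝ) + n * Real.logb 2 n) ≤
            (AsymRAM.work (AsymRAM.fftDAG k) ω P : ℝ) := by
  refine ⟨1 / 12, by norm_num, ?_⟩
  rintro M ω k n hM hω rfl P σ τ h
  have hlog : Real.logb 2 ((2 ^ k : ℕ) : ℝ) = k := by simp [Real.logb_pow]
  rw [hlog]
  refine ⟨fun hωM hout => ?_, ?_⟩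
  · have hx : (1 : ℝ) < ω * M := by exact_mod_cast hωM
    have hL := Real.logb_pos (b := 2) (by norm_num) hx
    have hmain := h.mul_two_pow_le_ioCost_mul hω hM hωM hout
    rw [mul_div_assoc', div_le_iff₀ hL]
    push_cast
    linarith
  · have h₁ : ((2 ^ k : ℕ) : ℝ) * k ≤ AsymRAM.work (AsymRAM.fftDAG k) ω P := by
      rw [mul_comm]
      exact_mod_cast h.mul_two_pow_le_work hω
    have h₂ : (AsymRAM.ioCost (AsymRAM.fftDAG k) ω P : ℝ) ≤
        AsymRAM.work (AsymRAM.fftDAG k) ω P := by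
      exact_mod_cast Nat.le_add_right _ _
    have h₃ : (0 : ℝ) ≤ AsymRAM.work (AsymRAM.fftDAG k) ω P := Nat.cast_nonneg _
    linarith
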